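/- All groups are abelian, written in the vocabulary $\{+,0\}$. For infinite cardinals $\lambda\le\kappa$, the logic $L_{\kappa\lambda}$ is the smallest collection of formulas that contains the atomic formulas and is closed under negation, under conjunctions and disjunctions of fewer than $\kappa$ formulas, and under existential and universal quantification over strings of fewer than $\lambda$ variables. Two groups are $L_{\kappa\lambda}$-equivalent if they satisfy the same $L_{\kappa\lambda}$-sentences. The Baer–Specker group $\mathbb{Z}^\omega$ is the product of countably many copies of $\mathbb{Z}$, and $e_n\in\mathbb{Z}^\omega$ is its $n$-th standard unit vector. A torsion-free group $G$ is slender if for every homomorphism $h:\mathbb{Z}^\omega\to G$ one has $h(e_n)=0$ for all but finitely many $n$. A group is $\aleph_1$-free if all its countable subgroups are free. A group $G$ is a Shelah group if it is $\aleph_1$-free and every countable subgroup $B$ of $G$ is contained in a countable subgroup $B'$ of $G$ such that, for every countable subgroup $C$ of $G$ with $C\cap B'=B$, the quotient $C/B$ is free. **Corollary 1.10.** Let $G$ be a Shelah group. Then $G$ is slender, and $\mathbb{Z}^\omega$ is not $L_{(2^{\aleph_0})^+\aleph_1}$-equivalent to $G$. -/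

import Mathlib

open scoped Cardinal

/-! ## The infinitary logics `L_{κλ}` -/

/-- Formulas of the infinitary logic `L_{κλ}` over the vocabulary `L`, with free variables in the
type `α`: the smallest collection containing the atomic formulas and closed under negation,
conjunctions and disjunctions of fewer than `κ` formulas, and existential and universal
quantification over strings of fewer than `λ` variables. Formulas are well-scoped: quantifying over
a string of variables indexed by `β` turns a formula in the variables `α ⊕ β` into one in the
variables `α`. -/
inductive InfFormula (L : FirstOrder.Language.{0, 0}) (κ lam : Cardinal.{0}) : Type → Type 1
  | equal {α : Type} (s t : L.Term α) : InfFormula L κ lam α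
  | rel {α : Type} {n : ℕ} (R : L.Relations n) (ts : Fin n → L.Term α) : InfFormula L κ lam α
  | neg {α : Type} (φ : InfFormula L κ lam α) : InfFormula L κ lam α
  | conj {α : Type} (ι : Type) (hι : #ι < κ) (φ : ι → InfFormula L κ lam α) : InfFormula L κ lam α
  | disj {α : Type} (ι : Type) (hι : #ι < κ) (φ : ι → InfFormula L κ lam α) : InfFormula L κ lam α
  | ex {α : Type} (β : Type) (hβ : #β < lam) (φ : InfFormula L κ lam (α ⊕ β)) : InfFormula L κ lam α
  | all {α : Type} (β : Type) (hβ : #β < lam) (φ : InfFormula L κ lam (α ⊕ β)) :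
      InfFormula L κ lam α

/-- Satisfaction of an `L_{κλ}`-formula in the structure `M` under the assignment `v`. -/
def InfFormula.Realize {L : FirstOrder.Language.{0, 0}} {κ lam : Cardinal.{0}}
    (M : Type*) [L.Structure M] : {α : Type} → InfFormula L κ lam α → (α → M) → Prop
  | _, .equal s t, v => s.realize v = t.realize v
  | _, .rel R ts, v => FirstOrder.Language.Structure.RelMap R fun i => (ts i).realize v
  | _, .neg φ, v => ¬ φ.Realize M v
  | _, .conj ι _ φ, v => ∀ i : ι, (φ i).Realize M v
  | _, .disj ι _ φ, v => ∃ i : ι, (φ i).Realize M v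
  | _, .ex β _ φ, v => ∃ w : β → M, φ.Realize M (Sum.elim v w)
  | _, .all β _ φ, v => ∀ w : β → M, φ.Realize M (Sum.elim v w)

/-- `L_{κλ}`-equivalence: `M` and `N` satisfy the same `L_{κλ}`-sentences, that is, the same
`L_{κλ}`-formulas without free variables. -/
def InfEquivalent (L : FirstOrder.Language.{0, 0}) (κ lam : Cardinal.{0})
    (M N : Type*) [L.Structure M] [L.Structure N] : Prop :=
  ∀ φ : InfFormula L κ lam Empty, φ.Realize M Empty.elim ↔ φ.Realize N Empty.elim

/-! ## The vocabulary of (abelian) groups -/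

/-- The function symbols of the vocabulary of groups: a constant `0` and a binary symbol `+`. -/
inductive GroupFunctions : ℕ → Type
  | zero : GroupFunctions 0
  | add : GroupFunctions 2

/-- The vocabulary of groups, with `0` and `+` and no relation symbols besides equality. -/
def groupLanguage : FirstOrder.Language.{0, 0} where
  Functions := GroupFunctions
  Relations := fun _ => Empty

/-- Every abelian group is a structure for the vocabulary of groups in the obvious way. -/
instance groupStructure (G : Type*) [AddCommGroup G] : groupLanguage.Structure G where
  funMap {n} (f : GroupFunctions n) :=
    match f with
    | .zero => fun _ => 0
    | .add => fun x => x 0 + x 1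
  RelMap {_} (r : Empty) := r.elim

/-! ## Classes of abelian groups -/

/-- An abelian group is slender if it is torsion-free and every homomorphism from the
Baer–Specker group `ℤ^ω` to it kills all but finitely many of the standard unit vectors. -/
def IsSlender (G : Type*) [AddCommGroup G] : Prop :=
  IsAddTorsionFree G ∧ ∀ h : (ℕ → ℤ) →+ G, {n : ℕ | h (Pi.single n 1) ≠ 0}.Finite

/-- An abelian group is `ℵ₁`-free if all its countable subgroups are free abelian. -/
def IsAlephOneFree (G : Type*) [AddCommGroup G] : Prop :=
  ∀ B : AddSubgroup G, Countable B → Module.Free ℤ B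

/-- An abelian group `G` is a Shelah group if it is `ℵ₁`-free and every countable subgroup `B` is
contained in a countable subgroup `B'` such that `C / B` is free for every countable subgroup `C`
with `C ∩ B' = B`. -/
def IsShelahGroup (G : Type*) [AddCommGroup G] : Prop :=
  IsAlephOneFree G ∧
    ∀ B : AddSubgroup G, Countable B → ∃ B' : AddSubgroup G, Countable B' ∧ B ≤ B' ∧
      ∀ C : AddSubgroup G, Countable C → C ⊓ B' = B → Module.Free ℤ (C ⧸ B.addSubgroupOf C)

/-! Both claims rest on one property, `HasDivisibleChains`, which no Shelah group has. Given `b`,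
let `B` be generated by `b`, take `B'` from the Shelah condition, and choose a chain `x` such that
no nonzero multiple of `x 0` lies in `B'`. Then `C = B + ⟨x⟩` meets `B'` exactly in `B`, yet in `C /
B` the nonzero class of `x 0` is divisible by every positive integer, so `C / B` is not free.
Conversely, let `h` be a homomorphism from `ℤ^ω` to a torsion-free group such that each `h (e_n)` is
indivisible by some `m n > 0`. The images of the masked vectors `∑ ε n * n! * ∏_{i<n} m i * e_n`
start chains and are pairwise distinct, so a countable set cannot block them all
(`hasDivisibleChains_of_hom`). The identity gives chains in `ℤ^ω`; a failure of slenderness would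
give them in `G`. Since the property is a sentence of the logic, the groups are not equivalent. -/

/-! ### Divisibility in free and `ℵ₁`-free groups -/

/-- In a free abelian group only `0` is divisible by every positive integer. -/
theorem eq_zero_of_free_of_forall_nsmul {M : Type*} [AddCommGroup M] [Module.Free ℤ M] {g : M}
    (hg : ∀ m : ℕ, 0 < m → ∃ y, m • y = g) : g = 0 := by
  let B := Module.Free.chooseBasis ℤ M
  refine B.repr.map_eq_zero_iff.1 (Finsupp.ext fun i => ?_)
  obtain ⟨y, hy⟩ := hg ((B.repr g i).natAbs + 1) (Nat.succ_pos _)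
  refine Int.eq_zero_of_abs_lt_dvd (m := ((B.repr g i).natAbs + 1 : ℕ)) ⟨B.repr y i, ?_⟩ ?_
  · conv_lhs => rw [← hy]
    rw [map_nsmul, Finsupp.smul_apply, nsmul_eq_mul]
  · push_cast
    simp

theorem AddSubgroup.countable_closure_range {M : Type*} [AddCommGroup M] {ι : Type*} [Countable ι]
    (y : ι → M) : Countable (AddSubgroup.closure (Set.range y)) := by
  have : (Finsupp.linearCombination ℤ y).range.toAddSubgroup
      = AddSubgroup.closure (Set.range y) := by
    rw [Finsupp.range_linearCombination, Submodule.span_int_eq_addSubgroupClosure]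
  rw [← this]
  exact (Set.countable_range (Finsupp.linearCombination ℤ y)).to_subtype

theorem IsAlephOneFree.isAddTorsionFree {G : Type*} [AddCommGroup G] (hG : IsAlephOneFree G) :
    IsAddTorsionFree G := by
  refine ⟨fun n hn a b hab => ?_⟩
  have hfree := hG (AddSubgroup.closure (Set.range fun _ : Unit => a - b))
    (AddSubgroup.countable_closure_range _)
  have hmem : a - b ∈ AddSubgroup.closure (Set.range fun _ : Unit => a - b) :=
    AddSubgroup.subset_closure ⟨(), rfl⟩
  have hzero : (n : ℤ) • (⟨a - b, hmem⟩ : AddSubgroup.closure (Set.range fun _ : Unit => a - b))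
      = 0 := by
    apply Subtype.ext
    simpa [smul_sub, sub_eq_zero] using hab
  have := (smul_eq_zero.1 hzero).resolve_left (by exact_mod_cast hn)
  exact sub_eq_zero.1 (congrArg Subtype.val this)

theorem IsAlephOneFree.exists_not_dvd {G : Type*} [AddCommGroup G] (hG : IsAlephOneFree G) {g : G}
    (hg : g ≠ 0) : ∃ m : ℕ, 0 < m ∧ ∀ y : G, m • y ≠ g := by
  by_contra! hdiv
  have hdiv' : ∀ m : ℕ, ∃ y : G, (m + 1) • y = g := fun m => hdiv (m + 1) m.succ_pos
  choose y hy using hdiv'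
  have hfree := hG (AddSubgroup.closure (Set.range y)) (AddSubgroup.countable_closure_range y)
  have hmem : ∀ m, y m ∈ AddSubgroup.closure (Set.range y) :=
    fun m => AddSubgroup.subset_closure ⟨m, rfl⟩
  have hgmem : g ∈ AddSubgroup.closure (Set.range y) := by
    have := hmem 0
    rwa [show y 0 = g by simpa using hy 0] at this
  have := eq_zero_of_free_of_forall_nsmul (g := (⟨g, hgmem⟩ : AddSubgroup.closure (Set.range y)))
    fun m hm => ⟨⟨y (m - 1), hmem _⟩, Subtype.ext (by
      have := hy (m - 1)
      rwa [Nat.sub_add_cancel hm] at this)⟩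
  exact hg (congrArg Subtype.val this)

/-! ### Divisible chains and Shelah groups -/

/-- There is a sequence `b` such that, outside any countable set, there are elements `x 0` with no
nonzero multiple in that set that are divisible by every `k !` modulo the group generated by `b`. -/
def HasDivisibleChains (M : Type*) [AddCommGroup M] : Prop :=
  ∃ b : ℕ → M, ∀ b' : ℕ → M, ∃ x : ℕ → M,
    (∀ k, ∃ j, x k = (k + 1) • x (k + 1) + b j) ∧ ∀ n j, (n + 1) • x 0 ≠ b' j

theorem exists_sub_zsmul_mem_of_chain {M : Type*} [AddCommGroup M] {B : AddSubgroup M} {x : ℕ → M}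
    (hx : ∀ k, x k - (k + 1) • x (k + 1) ∈ B) (k d : ℕ) : ∃ q : ℤ, x k - q • x (k + d) ∈ B := by
  induction d with
  | zero => exact ⟨1, by simp⟩
  | succ d ih =>
    obtain ⟨q, hq⟩ := ih
    refine ⟨q * (k + d + 1 : ℕ), ?_⟩
    have := B.add_mem hq (B.zsmul_mem (hx (k + d)) q)
    rw [smul_sub, sub_add_sub_cancel, ← natCast_zsmul, smul_smul] at this
    exact this

theorem sub_factorial_nsmul_mem_of_chain {M : Type*} [AddCommGroup M] {B : AddSubgroup M}
    {x : ℕ → M} (hx : ∀ k, x k - (k + 1) • x (k + 1) ∈ B) (k : ℕ) :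
    x 0 - k.factorial • x k ∈ B := by
  induction k with
  | zero => simp
  | succ k ih =>
    have := B.add_mem ih (B.nsmul_mem (hx k) k.factorial)
    rw [smul_sub, sub_add_sub_cancel, smul_smul, mul_comm] at this
    exact this

/-- Modulo `B` each `x k` is a multiple of every later term, so the subgroups `⟨x k⟩` form an
increasing chain of cyclic groups. -/
theorem exists_sub_zsmul_mem_of_mem_closure {M : Type*} [AddCommGroup M] {B : AddSubgroup M}
    {x : ℕ → M} (hx : ∀ k, x k - (k + 1) • x (k + 1) ∈ B) {c : M}
    (hc : c ∈ B ⊔ AddSubgroup.closure (Set.range x)) : ∃ (n : ℤ) (k : ℕ), c - n • x k ∈ B := by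
  obtain ⟨b, hb, y, hy, rfl⟩ := AddSubgroup.mem_sup.1 hc
  suffices h : ∃ (n : ℤ) (k : ℕ), y - n • x k ∈ B by
    obtain ⟨n, k, h⟩ := h
    exact ⟨n, k, by rw [add_sub_assoc]; exact B.add_mem hb h⟩
  clear hc
  induction hy using AddSubgroup.closure_induction with
  | mem y hy =>
    obtain ⟨k, rfl⟩ := hy
    exact ⟨1, k, by simp⟩
  | zero => exact ⟨0, 0, by simp⟩
  | add y z _ _ ihy ihz =>
    obtain ⟨n, k, hk⟩ := ihy
    obtain ⟨m, l, hl⟩ := ihz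
    obtain ⟨q, hq⟩ := exists_sub_zsmul_mem_of_chain hx k l
    obtain ⟨r, hr⟩ := exists_sub_zsmul_mem_of_chain hx l k
    refine ⟨n * q + m * r, k + l, ?_⟩
    rw [add_comm l k] at hr
    have := B.add_mem (B.add_mem hk (B.zsmul_mem hq n)) (B.add_mem hl (B.zsmul_mem hr m))
    convert this using 1
    module
  | neg y _ ih =>
    obtain ⟨n, k, hk⟩ := ih
    refine ⟨-n, k, ?_⟩
    convert B.neg_mem hk using 1
    module

theorem IsShelahGroup.not_hasDivisibleChains {G : Type*} [AddCommGroup G] (hG : IsShelahGroup G) :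
    ¬ HasDivisibleChains G := by
  rintro ⟨b, hb⟩
  set B := AddSubgroup.closure (Set.range b) with hB
  have hBc : Countable B := AddSubgroup.countable_closure_range b
  obtain ⟨B', hB'c, hBB', hfree⟩ := hG.2 B hBc
  obtain ⟨b', hb'⟩ := exists_surjective_nat B'
  obtain ⟨x, hx, hx0⟩ := hb fun j => (b' j : G)
  have hxB : ∀ k, x k - (k + 1) • x (k + 1) ∈ B := fun k => by
    obtain ⟨j, hj⟩ := hx k
    rw [hj, add_sub_cancel_left]
    exact AddSubgroup.subset_closure ⟨j, rfl⟩
  have hx0' : ∀ n : ℤ, n • x 0 ∈ B' → n = 0 := fun n hn => by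
    by_contra hne
    have hmem : n.natAbs • x 0 ∈ B' := by
      rcases Int.natAbs_eq n with h | h
      · rwa [h, natCast_zsmul] at hn
      · rw [h, neg_smul, natCast_zsmul] at hn
        exact neg_mem_iff.1 hn
    obtain ⟨j, hj⟩ := hb' ⟨_, hmem⟩
    refine hx0 (n.natAbs - 1) j ?_
    rw [hj, Nat.sub_add_cancel (Int.natAbs_pos.2 hne)]
  set C := B ⊔ AddSubgroup.closure (Set.range x) with hC
  have hxC : ∀ k, x k ∈ C := fun k =>
    (le_sup_right : _ ≤ C) (AddSubgroup.subset_closure ⟨k, rfl⟩)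
  have hCc : Countable C := by
    have : C = AddSubgroup.closure (Set.range (Sum.elim b x)) := by
      rw [Set.Sum.elim_range, AddSubgroup.closure_union]
    rw [this]
    exact AddSubgroup.countable_closure_range _
  have hCB : C ⊓ B' = B := by
    refine le_antisymm ?_ (le_inf le_sup_left hBB')
    rintro c ⟨hcC, hcB'⟩
    obtain ⟨n, k, hk⟩ := exists_sub_zsmul_mem_of_mem_closure hxB hcC
    -- Multiplying `c ≡ n • x k` by `k!` turns `x k` into `x 0` modulo `B`, so `n • x 0 ∈ B'`.
    have hn : n = 0 := hx0' n <| by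
      have h1 := B'.nsmul_mem hcB' k.factorial
      have h2 := hBB' (B.nsmul_mem hk k.factorial)
      have h3 := hBB' (B.zsmul_mem (sub_factorial_nsmul_mem_of_chain hxB k) n)
      convert B'.add_mem h3 (B'.sub_mem h1 h2) using 1
      module
    simpa [hn] using hk
  have hfree := hfree C hCc hCB
  have hzero := eq_zero_of_free_of_forall_nsmul
    (g := ((⟨x 0, hxC 0⟩ : C) : C ⧸ B.addSubgroupOf C)) fun m hm => by
    refine ⟨(((m - 1).factorial • (⟨x m, hxC m⟩ : C) : C) : C ⧸ B.addSubgroupOf C), ?_⟩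
    rw [← QuotientAddGroup.mk_nsmul, smul_smul, Nat.mul_factorial_pred hm.ne']
    rw [QuotientAddGroup.eq, AddSubgroup.mem_addSubgroupOf]
    convert sub_factorial_nsmul_mem_of_chain hxB m using 1
    simp [sub_eq_neg_add]
  rw [QuotientAddGroup.eq_zero_iff, AddSubgroup.mem_addSubgroupOf] at hzero
  exact one_ne_zero (hx0' 1 (by simpa using hBB' hzero))

/-! ### Chains from homomorphisms on `ℤ^ω` -/

/-- The coefficients `(n ! / k !) * ∏_{i < n} m i` for `n ≥ k`, and `0` for `n < k`, masked by
`ε`. -/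
def chainVector (m : ℕ → ℕ) (ε : ℕ → Bool) (k : ℕ) : ℕ → ℤ := fun n =>
  if ε n ∧ k ≤ n then ((n.factorial / k.factorial * ∏ i ∈ Finset.range n, m i : ℕ) : ℤ) else 0

theorem chainVector_eq (m : ℕ → ℕ) (ε : ℕ → Bool) (k : ℕ) :
    chainVector m ε k = (k + 1) • chainVector m ε (k + 1) +
      if ε k then (∏ i ∈ Finset.range k, m i) • Pi.single k (1 : ℤ) else 0 := by
  funext n
  have hsingle : (if ε k then (∏ i ∈ Finset.range k, m i) • Pi.single k (1 : ℤ) else 0 : ℕ → ℤ) n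
      = if ε n ∧ n = k then ((∏ i ∈ Finset.range k, m i : ℕ) : ℤ) else 0 := by
    by_cases h : n = k
    · subst h
      cases hε : ε n <;> simp
    · cases hε : ε k <;> simp [h]
  rw [Pi.add_apply, hsingle, Pi.smul_apply, nsmul_eq_mul]
  unfold chainVector
  cases hε : ε n
  · simp
  rcases lt_trichotomy n k with h | rfl | h
  · simp [h.not_ge, h.ne, (h.trans (Nat.lt_succ_self k)).not_ge]
  · simp [Nat.div_self (Nat.factorial_pos n)]
  · have h1 : k + 1 ≤ n := h
    have hdiv : n.factorial / k.factorial = (k + 1) * (n.factorial / (k + 1).factorial) := by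
      obtain ⟨c, hc⟩ := Nat.factorial_dvd_factorial h1
      rw [hc, Nat.mul_div_cancel_left _ (Nat.factorial_pos _), Nat.factorial_succ,
        mul_comm (k + 1), mul_assoc, Nat.mul_div_cancel_left _ (Nat.factorial_pos _)]
    simp only [h.le, h1, h.ne', hdiv, and_self, and_false, if_true, if_false]
    push_cast
    ring

/-- If `ε` and `δ` first differ at `n`, the images of their chain vectors differ. -/
theorem map_chainVector_ne {G : Type*} [AddCommGroup G] [IsAddTorsionFree G]
    (h : (ℕ → ℤ) →+ G) {m : ℕ → ℕ} (hm0 : ∀ n, 0 < m n)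
    (hm : ∀ n y, m n • y ≠ h (Pi.single n 1)) {ε δ : ℕ → Bool} {n : ℕ}
    (hlt : ∀ i < n, ε i = δ i) (hε : ε n = true) (hδ : δ n = false) :
    h (chainVector m ε 0) ≠ h (chainVector m δ 0) := by
  intro heq
  set a : ℕ → ℕ := fun n => n.factorial * ∏ i ∈ Finset.range n, m i with ha
  have ha0 : a n ≠ 0 :=
    (Nat.mul_pos n.factorial_pos (Finset.prod_pos fun i _ => hm0 i)).ne'
  have hdvd : ∀ i, n + 1 ≤ i → a (n + 1) ∣ a i := fun i hi =>
    Nat.mul_dvd_mul (Nat.factorial_dvd_factorial hi)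
      (Finset.prod_dvd_prod_of_subset _ _ _ (Finset.range_subset_range.2 hi))
  have hexp : ∀ ε : ℕ → Bool, ∀ i, chainVector m ε 0 i = if ε i then (a i : ℤ) else 0 :=
    fun ε i => by simp [chainVector, ha]
  let y : ℕ → ℤ := fun i => if n + 1 ≤ i then
    ((if ε i then 1 else 0) - (if δ i then 1 else 0)) * ((a i / a (n + 1) : ℕ) : ℤ) else 0
  have hdecomp : chainVector m ε 0 - chainVector m δ 0
      = a n • Pi.single n (1 : ℤ) + a (n + 1) • y := by
    funext i
    rw [Pi.sub_apply, Pi.add_apply, Pi.smul_apply, Pi.smul_apply, hexp, hexp, nsmul_eq_mul,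
      nsmul_eq_mul]
    rcases lt_trichotomy i n with hi | rfl | hi
    · simp [y, hlt i hi, hi.ne]
    · simp [y, hε, hδ]
    · have hi' : n + 1 ≤ i := hi
      obtain ⟨c, hc⟩ := hdvd i hi'
      have hpos : 0 < a (n + 1) :=
        Nat.mul_pos (n + 1).factorial_pos (Finset.prod_pos fun i _ => hm0 i)
      simp only [y, hi', if_true, hc, Nat.mul_div_cancel_left _ hpos, Pi.single_eq_of_ne hi.ne']
      push_cast
      split_ifs <;> ring
  have hzero : h (a n • Pi.single n (1 : ℤ) + a (n + 1) • y) = 0 := by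
    rw [← hdecomp, map_sub, heq, sub_self]
  have hsucc : a (n + 1) = a n * (m n * (n + 1)) := by
    simp only [ha, Nat.factorial_succ, Finset.prod_range_succ]
    ring
  -- Cancelling `a n` by torsion-freeness leaves `h (e_n)` divisible by `m n`; this is why the
  -- coefficients carry the product of the `m i`.
  rw [map_add, map_nsmul, map_nsmul, hsucc, mul_smul (a n), ← smul_add, mul_smul (m n)] at hzero
  have := (nsmul_eq_zero_iff_right ha0).1 hzero
  refine hm n (-((n + 1) • h y)) ?_
  rw [smul_neg]
  exact (eq_neg_of_add_eq_zero_left this).symm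

theorem map_chainVector_injective {G : Type*} [AddCommGroup G] [IsAddTorsionFree G]
    (h : (ℕ → ℤ) →+ G) {m : ℕ → ℕ} (hm0 : ∀ n, 0 < m n)
    (hm : ∀ n y, m n • y ≠ h (Pi.single n 1)) :
    Function.Injective fun ε => h (chainVector m ε 0) := by
  intro ε δ heq
  by_contra hne
  have hex : ∃ n, ε n ≠ δ n := Function.ne_iff.1 hne
  classical
  have hspec := Nat.find_spec hex
  have hlt : ∀ i < Nat.find hex, ε i = δ i := fun i hi => not_not.1 (Nat.find_min hex hi)
  cases hε : ε (Nat.find hex) <;> cases hδ : δ (Nat.find hex)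
  · exact hspec (hε.trans hδ.symm)
  · exact map_chainVector_ne h hm0 hm (fun i hi => (hlt i hi).symm) hδ hε heq.symm
  · exact map_chainVector_ne h hm0 hm hlt hε hδ heq
  · exact hspec (hε.trans hδ.symm)

theorem hasDivisibleChains_of_hom {G : Type*} [AddCommGroup G] [IsAddTorsionFree G]
    (h : (ℕ → ℤ) →+ G) (hred : ∀ n, ∃ m : ℕ, 0 < m ∧ ∀ y : G, m • y ≠ h (Pi.single n 1)) :
    HasDivisibleChains G := by
  choose m hm0 hm using hred
  -- The entry `b 0 = 0` serves the indices masked out by `ε`, so one `b` works for all `ε`.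
  let b : ℕ → G := fun j =>
    j.casesOn 0 fun k => (∏ i ∈ Finset.range k, m i) • h (Pi.single k 1)
  refine ⟨b, fun b' => ?_⟩
  have hcount : {g : G | ∃ n j, (n + 1) • g = b' j}.Countable := by
    have : {g : G | ∃ n j, (n + 1) • g = b' j} = ⋃ n : ℕ, ⋃ j, {g | (n + 1) • g = b' j} := by
      ext g
      simp
    rw [this]
    refine Set.countable_iUnion fun n => Set.countable_iUnion fun j =>
      Set.Subsingleton.countable fun g hg g' hg' => ?_
    -- In a torsion-free group division by `n + 1` has at most one result.
    exact nsmul_right_injective n.succ_ne_zero (Eq.trans hg (Eq.symm hg'))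
  obtain ⟨ε, hε⟩ : ∃ ε, h (chainVector m ε 0) ∉ {g : G | ∃ n j, (n + 1) • g = b' j} := by
    by_contra! hall
    have := hcount.preimage_of_injOn (map_chainVector_injective h hm0 hm).injOn
    have : Countable (ℕ → Bool) := Set.countable_univ_iff.1 (this.mono fun ε _ => hall ε)
    obtain ⟨f, hf⟩ := exists_surjective_nat (ℕ → Bool)
    obtain ⟨n, hn⟩ := hf fun n => !f n n
    simpa using congrFun hn n
  refine ⟨fun k => h (chainVector m ε k), fun k => ?_, fun n j hnj => hε ⟨n, j, hnj⟩⟩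
  have hk := congrArg h (chainVector_eq m ε k)
  rw [map_add, map_nsmul] at hk
  cases hεk : ε k
  · exact ⟨0, by simpa [hεk, b] using hk⟩
  · exact ⟨k + 1, by simpa only [hεk, if_true, map_nsmul] using hk⟩

theorem hasDivisibleChains_int : HasDivisibleChains (ℕ → ℤ) := by
  refine hasDivisibleChains_of_hom (AddMonoidHom.id _) fun n => ⟨2, two_pos, fun y hy => ?_⟩
  have := congrFun hy n
  simp at this
  omega

theorem IsShelahGroup.isSlender {G : Type*} [AddCommGroup G] (hG : IsShelahGroup G) :
    IsSlender G := by
  have := hG.1.isAddTorsionFree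
  refine ⟨this, fun h => ?_⟩
  by_contra hinf
  let s := Set.Infinite.natEmbedding _ hinf
  have hs : Function.Injective fun n => (s n : ℕ) := Subtype.val_injective.comp s.injective
  -- Reindexing along `s` sends `e_n` to `e_(s n)`, so `h'` kills no unit vector.
  let h' : (ℕ → ℤ) →+ G := h.comp (Function.ExtendByZero.hom ℤ fun n => (s n : ℕ))
  have hsingle : ∀ n, h' (Pi.single n 1) = h (Pi.single (s n : ℕ) 1) := fun n => by
    refine congrArg h (funext fun i => ?_)
    by_cases hi : ∃ k, (s k : ℕ) = i
    · obtain ⟨k, rfl⟩ := hi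
      have := hs.extend_apply (Pi.single n (1 : ℤ)) 0 k
      simpa [Function.ExtendByZero.hom, Pi.single_apply, hs.eq_iff, Subtype.val_inj] using this
    · have hne : i ≠ (s n : ℕ) := fun e => hi ⟨n, e.symm⟩
      rw [Pi.single_eq_of_ne hne]
      exact Function.extend_apply' _ _ _ hi
  refine hG.not_hasDivisibleChains (hasDivisibleChains_of_hom h' fun n => ?_)
  rw [hsingle]
  exact hG.1.exists_not_dvd (s n).2

/-! ### Expressing divisible chains in the logic -/

/-- The term `n • t`. -/
def nsmulTerm {α : Type} (n : ℕ) (t : groupLanguage.Term α) : groupLanguage.Term α :=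
  n.rec (.func GroupFunctions.zero Fin.elim0) fun _ u => .func GroupFunctions.add ![u, t]

theorem realize_addTerm {α : Type} {G : Type*} [AddCommGroup G] (s t : groupLanguage.Term α)
    (v : α → G) : (FirstOrder.Language.Term.func (L := groupLanguage) GroupFunctions.add
      ![s, t]).realize v = s.realize v + t.realize v := rfl

theorem realize_nsmulTerm {α : Type} {G : Type*} [AddCommGroup G] (n : ℕ)
    (t : groupLanguage.Term α) (v : α → G) : (nsmulTerm n t).realize v = n • t.realize v := by
  induction n with
  | zero => rw [zero_smul]; rfl
  | succ n ih => rw [succ_nsmul, ← ih]; rfl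

theorem mk_nat_lt_succ_continuum : #ℕ < Order.succ (2 ^ ℵ₀ : Cardinal.{0}) :=
  Order.lt_succ_of_le (by simpa using (Cardinal.cantor ℵ₀).le)

theorem mk_bool_lt_succ_continuum : #Bool < Order.succ (2 ^ ℵ₀ : Cardinal.{0}) :=
  (Cardinal.lt_aleph0_of_finite Bool).trans (by simpa using mk_nat_lt_succ_continuum)

theorem mk_nat_lt_aleph_one : #ℕ < Cardinal.aleph.{0} 1 := by
  simp

/-- The sentence saying that a group has divisible chains. -/
noncomputable def divisibleChainsSentence :
    InfFormula groupLanguage (Order.succ (2 ^ ℵ₀)) (Cardinal.aleph 1) Empty :=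
  .ex ℕ mk_nat_lt_aleph_one <| .all ℕ mk_nat_lt_aleph_one <| .ex ℕ mk_nat_lt_aleph_one <|
    -- The index `i` is both the chain position `k` and the code of the pair `(n, j)`.
    .conj ℕ mk_nat_lt_succ_continuum fun i =>
      .conj Bool mk_bool_lt_succ_continuum fun c => bif c
        then .neg <| .equal (nsmulTerm (i.unpair.1 + 1) (.var (.inr 0)))
          (.var (.inl (.inr i.unpair.2)))
        else .disj ℕ mk_nat_lt_succ_continuum fun j =>
          .equal (.var (.inr i)) (.func GroupFunctions.add
            ![nsmulTerm (i + 1) (.var (.inr (i + 1))), .var (.inl (.inl (.inr j)))])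

theorem realize_divisibleChainsSentence (G : Type*) [AddCommGroup G] :
    divisibleChainsSentence.Realize G Empty.elim ↔ HasDivisibleChains G := by
  simp only [divisibleChainsSentence, InfFormula.Realize, HasDivisibleChains, Bool.forall_bool,
    cond_true, cond_false, realize_addTerm, realize_nsmulTerm, FirstOrder.Language.Term.realize_var,
    Sum.elim_inl, Sum.elim_inr]
  refine exists_congr fun b => forall_congr' fun b' => exists_congr fun x => ?_
  refine ⟨fun h => ⟨fun k => (h k).1, fun n j => ?_⟩, fun h i => ⟨h.1 i, h.2 _ _⟩⟩
  simpa using (h (Nat.pair n j)).2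

/-- A Shelah group `G` is slender, and the Baer–Specker group `ℤ^ω` is not
`L_{(2^{ℵ₀})⁺ ℵ₁}`-equivalent to `G`. -/
theorem corollary1p10 {G : Type*} [AddCommGroup G] (hG : IsShelahGroup G) :
    IsSlender G ∧
      ¬ InfEquivalent groupLanguage (Order.succ (2 ^ ℵ₀)) (Cardinal.aleph 1) (ℕ → ℤ) G := by
  refine ⟨hG.isSlender, fun h => hG.not_hasDivisibleChains ?_⟩
  rw [← realize_divisibleChainsSentence, ← h]
  exact (realize_divisibleChainsSentence _).2 hasDivisibleChains_int
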